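/- Let $\Xi$ be a finite set of $n$ unknowns and let $\Sigma$ be an alphabet. A word equation $u=v$ consists of two words $u,v\in\Xi^*$; a morphism $h:\Xi^*\to\Sigma^*$ (which may map unknowns to the empty word) satisfies it if $h(u)=h(v)$. The equation is balanced if every unknown $x\in\Xi$ occurs the same number of times in $u$ as in $v$. The rank of a morphism $h:\Xi^*\to\Sigma^*$ is the smallest $r$ for which there is a set $A$ of $r$ words over $\Sigma$ with $h(x)\in A^*$ for every $x\in\Xi$. The entire system $K_h$ is the set of all word equations $u=v$ with $u,v\in\Xi^*$ satisfied by $h$. If $g,h:\Xi^*\to\Sigma^*$ are morphisms of rank $n-1$ and $K_g\neq K_h$, then every equation in $K_g\cap K_h$ is balanced. -/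

import Mathlib

/-- A (coefficient-free) word equation `u = v` over the set of unknowns `X`:
the pair of its two sides, which are words over `X`. -/
structure WordEquation (X : Type*) where
  lhs : FreeMonoid X
  rhs : FreeMonoid X

namespace WordEquation

/-- The morphism `h` is a solution of (satisfies) the equation `u = v` if `h u = h v`. -/
def IsSolution {X S : Type*} (E : WordEquation X) (h : FreeMonoid X →* FreeMonoid S) : Prop :=
  h E.lhs = h E.rhs

/-- The equation `u = v` is balanced if every unknown occurs equally often in `u` and in `v`. -/
def Balanced {X : Type*} [DecidableEq X] (E : WordEquation X) : Prop :=
  ∀ x : X, E.lhs.toList.count x = E.rhs.toList.count x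

/-- The entire system `K_h` generated by `h`: the set of all equations satisfied by `h`. -/
def entireSystem {X S : Type*} (h : FreeMonoid X →* FreeMonoid S) : Set (WordEquation X) :=
  {E | E.IsSolution h}

end WordEquation

/-- The (combinatorial) rank of a morphism `h`: the smallest `r` such that there is a set `A` of
`r` words with `h x ∈ A*` for every unknown `x`. -/
noncomputable def morphismRank {X S : Type*} (h : FreeMonoid X →* FreeMonoid S) : ℕ :=
  sInf {r : ℕ | ∃ A : Finset (FreeMonoid S), A.card = r ∧
    ∀ x : X, h (FreeMonoid.of x) ∈ Submonoid.closure (A : Set (FreeMonoid S))}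

/-- For finitely many unknowns the infimum in the definition of the rank is over a nonempty set. -/
theorem morphismRank_set_nonempty {X S : Type*} [Fintype X]
    (h : FreeMonoid X →* FreeMonoid S) :
    {r : ℕ | ∃ A : Finset (FreeMonoid S), A.card = r ∧
      ∀ x : X, h (FreeMonoid.of x) ∈ Submonoid.closure (A : Set (FreeMonoid S))}.Nonempty := by
  classical
  refine ⟨_, Finset.univ.image (fun x : X => h (FreeMonoid.of x)), rfl, fun x => ?_⟩
  exact Submonoid.subset_closure (by simp)

/-! Let `g` and `h` both satisfy an unbalanced equation `E`; by symmetry `K_g ⊆ K_h` suffices.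
Composing `h` with jointly faithful representations of words in a group `G` reduces this to
morphisms `ψ` into `G` satisfying `E` (`eq_of_unbalanced`). As long as `g` is nonerasing, `E` forces
`g` through an elementary morphism `x ↦ yx`. So does `ψ`, since `G` has inverses; unbalancedness
survives and `g` gets shorter. Once `g` erases some `x`, the defect theorem makes it injective on
the other letters, so the equations of `g` are exactly those trivial after erasing `x`. Then `E` is
unbalanced in `x` alone, which in a suitable `G` forces `ψ x = 1`, and `ψ` satisfies every equation
of `g`. The group `ℤ[T;T⁻¹] ⋊ ℤ` is suitable (`killsErased`) and represents words faithfully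
(`eq_of_position_eq`). -/

open FreeMonoid LaurentPolynomial

namespace WordEquation

/-! ### Prefix comparison of words -/

section Words

variable {X S : Type*}

theorem exists_eq_of_mul {w : FreeMonoid X} (h : w ≠ 1) : ∃ x w', w = of x * w' := by
  induction w using FreeMonoid.casesOn with
  | one => exact absurd rfl h
  | of_mul x w' => exact ⟨x, w', rfl⟩

theorem of_mul_inj {x y : X} {u v : FreeMonoid X} :
    of x * u = of y * v ↔ x = y ∧ u = v :=
  List.cons.injEq x u y v ▸ Iff.rfl

/-- Two distinct words are either prefix comparable, or differ in a letter following their longest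
common prefix. -/
theorem exists_prefix_of_ne {u v : FreeMonoid X} (h : u ≠ v) :
    (∃ w, w ≠ 1 ∧ (u = v * w ∨ v = u * w)) ∨
      ∃ p x y u' v', x ≠ y ∧ u = p * (of x * u') ∧ v = p * (of y * v') := by
  induction u using FreeMonoid.inductionOn' generalizing v with
  | one => exact Or.inl ⟨v, h.symm, Or.inr (one_mul v).symm⟩
  | of_mul x u ih =>
    rcases eq_or_ne v 1 with rfl | hv
    · exact Or.inl ⟨_, h, Or.inl (one_mul _).symm⟩
    obtain ⟨y, v, rfl⟩ := exists_eq_of_mul hv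
    rcases eq_or_ne x y with rfl | hxy
    · rcases ih (fun e => h (by rw [e])) with ⟨w, hw, e | e⟩ | ⟨p, a, b, u', v', hab, e, e'⟩
      · exact Or.inl ⟨w, hw, Or.inl (by rw [e, mul_assoc])⟩
      · exact Or.inl ⟨w, hw, Or.inr (by rw [e, mul_assoc])⟩
      · exact Or.inr ⟨of x * p, a, b, u', v', hab, by rw [e, mul_assoc], by rw [e', mul_assoc]⟩
    · exact Or.inr ⟨1, x, y, u, v, hxy, (one_mul _).symm, (one_mul _).symm⟩

theorem eq_mul_of_mul_eq_mul {a b c d : FreeMonoid S} (h : a * c = b * d)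
    (hl : b.length ≤ a.length) : ∃ w, a = b * w := by
  have hp : b.toList <+: a.toList :=
    List.prefix_of_prefix_length_le (l₃ := (a * c).toList)
      ⟨d.toList, by rw [h, toList_mul]⟩ ⟨c.toList, by rw [toList_mul]⟩ hl
  obtain ⟨w, hw⟩ := hp
  exact ⟨ofList w, hw.symm⟩

end Words

/-! ### Elementary morphisms and the descent on total length -/

section Elementary

variable {X S : Type*} [DecidableEq X]

/-- The elementary morphism `x ↦ y * x` fixing all the other letters. -/
def elementary (x y : X) : FreeMonoid X →* FreeMonoid X :=
  lift fun z => if z = x then of y * of x else of z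

theorem elementary_of_self (x y : X) : elementary x y (of x) = of y * of x := by
  simp [elementary]

theorem elementary_of_ne {x z : X} (y : X) (h : z ≠ x) : elementary x y (of z) = of z := by
  simp [elementary, h]

/-- Every `x` in an image is immediately preceded by a `y`. -/
theorem elementary_ne_of_mul {x y : X} (hxy : x ≠ y) (w w' : FreeMonoid X) :
    elementary x y w ≠ of x * w' := by
  induction w using FreeMonoid.casesOn with
  | one => exact fun h => List.cons_ne_nil _ _ h.symm
  | of_mul z w =>
    rcases eq_or_ne z x with rfl | hz
    · rw [map_mul, elementary_of_self, mul_assoc]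
      exact fun h => hxy (of_mul_inj.1 h).1.symm
    · rw [map_mul, elementary_of_ne y hz]
      exact fun h => hz (of_mul_inj.1 h).1

theorem count_elementary_of_ne {x y z : X} (hz : z ≠ y) (w : FreeMonoid X) :
    (elementary x y w).toList.count z = w.toList.count z := by
  induction w using FreeMonoid.inductionOn' with
  | one => simp
  | of_mul a w ih =>
    rcases eq_or_ne a x with rfl | ha
    · rw [map_mul, elementary_of_self, mul_assoc, toList_of_mul, toList_of_mul, toList_of_mul,
        List.count_cons_of_ne hz.symm, List.count_cons, List.count_cons, ih]
    · rw [map_mul, elementary_of_ne y ha, toList_of_mul, toList_of_mul, List.count_cons,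
        List.count_cons, ih]

theorem count_elementary_self {x y : X} (hxy : x ≠ y) (w : FreeMonoid X) :
    (elementary x y w).toList.count y = w.toList.count y + w.toList.count x := by
  induction w using FreeMonoid.inductionOn' with
  | one => simp
  | of_mul a w ih =>
    rcases eq_or_ne a x with rfl | ha
    · rw [map_mul, elementary_of_self, mul_assoc, toList_of_mul, toList_of_mul, toList_of_mul,
        List.count_cons_self, List.count_cons_of_ne hxy, List.count_cons_of_ne hxy,
        List.count_cons_self, ih]
      omega
    · rw [map_mul, elementary_of_ne y ha, toList_of_mul, toList_of_mul, List.count_cons,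
        List.count_cons_of_ne ha, List.count_cons, ih]
      omega

/-- An elementary morphism acts on vectors of letter counts by an invertible matrix. -/
theorem count_eq_of_count_elementary_eq {x y : X} (hxy : x ≠ y) {u v : FreeMonoid X}
    (h : ∀ z, (elementary x y u).toList.count z = (elementary x y v).toList.count z) (z : X) :
    u.toList.count z = v.toList.count z := by
  have key : ∀ z, z ≠ y → u.toList.count z = v.toList.count z := fun z hz => by
    have := h z
    rwa [count_elementary_of_ne hz, count_elementary_of_ne hz] at this
  rcases eq_or_ne z y with rfl | hz
  · have := h z
    rw [count_elementary_self hxy, count_elementary_self hxy, key x hxy] at this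
    omega
  · exact key z hz

/-- Every morphism into a group factors through an elementary morphism. -/
theorem exists_comp_elementary {G : Type*} [Group G] (ψ : FreeMonoid X →* G) {x y : X}
    (hxy : x ≠ y) : ∃ ψ' : FreeMonoid X →* G, ψ = ψ'.comp (elementary x y) := by
  refine ⟨lift (Function.update (fun z => ψ (of z)) x ((ψ (of y))⁻¹ * ψ (of x))),
    hom_eq fun z => ?_⟩
  rcases eq_or_ne z x with rfl | hz
  · simp [elementary_of_self, hxy.symm]
  · simp [elementary_of_ne y hz, hz]

/-- The total length of the images of the letters. -/
def totalLength [Fintype X] (g : FreeMonoid X →* FreeMonoid S) : ℕ :=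
  ∑ x, (g (of x)).length

theorem exists_comp_elementary_of_eq_mul [Fintype X] {g : FreeMonoid X →* FreeMonoid S} {x y : X}
    (hxy : x ≠ y) (hy : g (of y) ≠ 1) {w : FreeMonoid S} (hw : g (of x) = g (of y) * w) :
    ∃ g' : FreeMonoid X →* FreeMonoid S,
      g = g'.comp (elementary x y) ∧ totalLength g' < totalLength g := by
  refine ⟨lift (Function.update (fun z => g (of z)) x w), hom_eq fun z => ?_, ?_⟩
  · rcases eq_or_ne z x with rfl | hz
    · simp [elementary_of_self, hxy.symm, hw]
    · simp [elementary_of_ne y hz, hz]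
  · have hpos : 0 < (g (of y)).length :=
      Nat.pos_of_ne_zero fun h => hy (length_eq_zero.1 h)
    refine Finset.sum_lt_sum (fun z _ => ?_) ⟨x, Finset.mem_univ x, ?_⟩
    · rcases eq_or_ne z x with rfl | hz
      · simp [hw]
      · simp [hz]
    · simp only [lift_eval_of, Function.update_self, hw, length_mul]
      omega

/-- A nonerasing solution of a nontrivial equation factors through an elementary morphism, which
keeps the equation nontrivial. -/
theorem exists_descent [Fintype X] {g : FreeMonoid X →* FreeMonoid S} {u v : FreeMonoid X}
    (hg : ∀ x, g (of x) ≠ 1) (huv : u ≠ v) (h : g u = g v) :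
    ∃ x y : X, x ≠ y ∧ elementary x y u ≠ elementary x y v ∧
      ∃ g' : FreeMonoid X →* FreeMonoid S,
        g = g'.comp (elementary x y) ∧ totalLength g' < totalLength g := by
  rcases exists_prefix_of_ne huv with ⟨w, hw, e⟩ | ⟨p, x, y, u', v', hxy, rfl, rfl⟩
  · exfalso
    have hgw : g w = 1 := by
      rcases e with rfl | rfl
      · rw [map_mul] at h
        exact mul_left_cancel (h.trans (mul_one _).symm)
      · rw [map_mul] at h
        exact mul_left_cancel (h.symm.trans (mul_one _).symm)
    obtain ⟨x, w', rfl⟩ := exists_eq_of_mul hw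
    rw [map_mul] at hgw
    exact hg x (List.append_eq_nil_iff.1 hgw).1
  · wlog hl : (g (of y)).length ≤ (g (of x)).length generalizing x y u' v'
    · obtain ⟨a, b, hab, hne, h'⟩ := this y x v' u' hxy.symm huv.symm h.symm (le_of_not_ge hl)
      exact ⟨a, b, hab, hne.symm, h'⟩
    rw [map_mul, map_mul, map_mul, map_mul] at h
    obtain ⟨w, hw⟩ := eq_mul_of_mul_eq_mul (mul_left_cancel h) hl
    refine ⟨x, y, hxy, fun e => ?_, exists_comp_elementary_of_eq_mul hxy (hg y) hw⟩
    simp only [map_mul, elementary_of_self, elementary_of_ne y hxy.symm, mul_assoc] at e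
    -- After cancelling the image of `p` and one `y`, the left side starts with `x`, while the right
    -- side is the image of `v'`.
    exact elementary_ne_of_mul hxy _ _ (mul_left_cancel (mul_left_cancel e)).symm

end Elementary

/-! ### Rank, erased letters and the defect theorem -/

section Rank

variable {X Y S : Type*}

theorem morphismRank_le_of_mem_closure [Fintype X] [Fintype Y] {g : FreeMonoid X →* FreeMonoid S}
    {g' : FreeMonoid Y →* FreeMonoid S}
    (h : ∀ A : Submonoid (FreeMonoid S), (∀ y, g' (of y) ∈ A) → ∀ x, g (of x) ∈ A) :
    morphismRank g ≤ morphismRank g' := by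
  obtain ⟨A, hA, hA'⟩ := Nat.sInf_mem (morphismRank_set_nonempty g')
  exact Nat.sInf_le ⟨A, hA, h _ hA'⟩

theorem morphismRank_comp_le [Fintype X] [Fintype Y] (g : FreeMonoid Y →* FreeMonoid S)
    (f : FreeMonoid X →* FreeMonoid Y) : morphismRank (g.comp f) ≤ morphismRank g := by
  refine morphismRank_le_of_mem_closure fun A hA x => ?_
  rw [MonoidHom.comp_apply]
  induction f (of x) using FreeMonoid.inductionOn' with
  | one => rw [map_one]; exact A.one_mem
  | of_mul y w ih => rw [map_mul]; exact A.mul_mem (hA y) ih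

theorem morphismRank_le_card [Fintype X] (g : FreeMonoid X →* FreeMonoid S) :
    morphismRank g ≤ Fintype.card X := by
  classical
  have hle : morphismRank g ≤ (Finset.univ.image (fun x : X => g (of x))).card :=
    Nat.sInf_le ⟨_, rfl, fun x => Submonoid.subset_closure (by simp)⟩
  exact hle.trans Finset.card_image_le

variable [DecidableEq X]

/-- The morphism erasing the letter `x`. -/
def erase (x : X) : FreeMonoid X →* FreeMonoid {z // z ≠ x} :=
  lift fun z => if hz : z ≠ x then of ⟨z, hz⟩ else 1

theorem erase_of_self (x : X) : erase x (of x) = 1 := by simp [erase]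

theorem erase_of_ne {x z : X} (h : z ≠ x) : erase x (of z) = of ⟨z, h⟩ := by simp [erase, h]

theorem count_erase {x z : X} (hz : z ≠ x) (w : FreeMonoid X) :
    (erase x w).toList.count ⟨z, hz⟩ = w.toList.count z := by
  induction w using FreeMonoid.inductionOn' with
  | one => simp
  | of_mul a w ih =>
    rcases eq_or_ne a x with rfl | ha
    · rw [map_mul, erase_of_self, one_mul, toList_of_mul, List.count_cons_of_ne hz.symm, ih]
    · rw [map_mul, erase_of_ne ha, toList_of_mul, toList_of_mul, List.count_cons,
        List.count_cons, ih]
      simp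

theorem comp_map_comp_erase {M : Type*} [Monoid M] {ψ : FreeMonoid X →* M} {x : X}
    (h : ψ (of x) = 1) : (ψ.comp (map Subtype.val)).comp (erase x) = ψ := by
  refine hom_eq fun z => ?_
  rcases eq_or_ne z x with rfl | hz
  · simp [erase_of_self, h]
  · simp [erase_of_ne hz]

theorem morphismRank_le_of_erase [Fintype X] {g : FreeMonoid X →* FreeMonoid S} {x : X}
    (h : g (of x) = 1) :
    morphismRank g ≤ morphismRank (g.comp (map (Subtype.val : {z // z ≠ x} → X))) := by
  conv_lhs => rw [← comp_map_comp_erase h]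
  exact morphismRank_comp_le _ _

/-- The defect theorem: a morphism of full rank is injective. -/
theorem injective_of_card_le_morphismRank [Fintype X] (g : FreeMonoid X →* FreeMonoid S)
    (hg : Fintype.card X ≤ morphismRank g) : Function.Injective g := by
  intro u v h
  by_contra huv
  induction hn : totalLength g using Nat.strong_induction_on generalizing g u v with
  | _ n ih =>
    subst hn
    by_cases hne : ∀ x, g (of x) ≠ 1
    · obtain ⟨x, y, -, huv', g', rfl, hlt⟩ := exists_descent hne huv h
      exact ih _ hlt g' (hg.trans (morphismRank_comp_le _ _)) h huv' rfl
    · push Not at hne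
      obtain ⟨x, hx⟩ := hne
      -- Erasing a letter leaves too few letters for full rank.
      have h1 := (hg.trans (morphismRank_le_of_erase hx)).trans (morphismRank_le_card _)
      exact absurd h1 (not_le.2 (Fintype.card_subtype_lt (x := x) (by simp)))

/-- A morphism of corank at most one erasing `x` satisfies only the equations that become trivial
after erasing `x`. -/
theorem eq_iff_erase_eq [Fintype X] {g : FreeMonoid X →* FreeMonoid S} {x : X}
    (hg : Fintype.card X ≤ morphismRank g + 1) (hx : g (of x) = 1) (u v : FreeMonoid X) :
    g u = g v ↔ erase x u = erase x v := by
  have hcard : Fintype.card {z // z ≠ x} = Fintype.card X - 1 := by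
    rw [Fintype.card_subtype_compl, Fintype.card_subtype_eq]
  have hinj := injective_of_card_le_morphismRank (g.comp (map (Subtype.val : {z // z ≠ x} → X)))
    (by have := morphismRank_le_of_erase hx; omega)
  conv_lhs => rw [← comp_map_comp_erase hx]
  exact hinj.eq_iff

end Rank

/-! ### Transfer of equations to group-valued morphisms -/

section Groups

/-- In the group `G`, an element `x` is killed by every relation between words that becomes
trivial after erasing `x` and in which `x` has nonzero exponent sum. -/
def KillsErased (X G : Type*) [DecidableEq X] [Group G] : Prop :=
  ∀ (ψ : FreeMonoid X →* G) (x : X) (u v : FreeMonoid X), erase x u = erase x v →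
    u.toList.count x ≠ v.toList.count x → ψ u = ψ v → ψ (of x) = 1

/-- A morphism of corank at most one satisfying an unbalanced equation `E` satisfies only
consequences of `E`, as far as morphisms into suitable groups are concerned. -/
theorem eq_of_unbalanced {X S G : Type*} [Fintype X] [DecidableEq X] [Group G]
    (hG : KillsErased X G) (g : FreeMonoid X →* FreeMonoid S)
    (hg : Fintype.card X ≤ morphismRank g + 1) {u v u' v' : FreeMonoid X}
    (hbal : ¬ ∀ z, u.toList.count z = v.toList.count z) (huv : g u = g v) (huv' : g u' = g v')
    (ψ : FreeMonoid X →* G) (hψ : ψ u = ψ v) : ψ u' = ψ v' := by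
  induction hn : totalLength g using Nat.strong_induction_on generalizing g u v u' v' ψ with
  | _ n ih =>
    subst hn
    by_cases hne : ∀ x, g (of x) ≠ 1
    · obtain ⟨x, y, hxy, -, g', rfl, hlt⟩ :=
        exists_descent hne (fun e => hbal fun z => by rw [e]) huv
      obtain ⟨ψ', rfl⟩ := exists_comp_elementary ψ hxy
      exact ih _ hlt g' (hg.trans (Nat.succ_le_succ (morphismRank_comp_le _ _)))
        (fun h => hbal (count_eq_of_count_elementary_eq hxy h)) huv huv' ψ' hψ rfl
    · push Not at hne
      obtain ⟨x, hx⟩ := hne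
      rw [eq_iff_erase_eq hg hx] at huv huv'
      -- Erasing `x` keeps the other counts, so the imbalance must be in `x`.
      have hcount : u.toList.count x ≠ v.toList.count x := by
        refine fun hc => hbal fun z => ?_
        rcases eq_or_ne z x with rfl | hz
        · exact hc
        · rw [← count_erase hz, ← count_erase hz, huv]
      have h1 := hG ψ x u v huv hcount hψ
      rw [← comp_map_comp_erase h1, MonoidHom.comp_apply, huv', ← MonoidHom.comp_apply]

end Groups

/-! ### The affine group over Laurent polynomials -/

section Affine

/-- The group of affine maps `p ↦ T ^ deg * p + shift` of the ring of Laurent polynomials. -/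
@[ext]
structure LaurentAffine where
  shift : ℤ[T;T⁻¹]
  deg : ℤ

namespace LaurentAffine

noncomputable instance : Mul LaurentAffine := ⟨fun a b => ⟨a.shift + T a.deg * b.shift, a.deg + b.deg⟩⟩
noncomputable instance : One LaurentAffine := ⟨⟨0, 0⟩⟩
noncomputable instance : Inv LaurentAffine := ⟨fun a => ⟨-(T (-a.deg) * a.shift), -a.deg⟩⟩

@[simp] theorem shift_mul (a b : LaurentAffine) :
    (a * b).shift = a.shift + T a.deg * b.shift := rfl
@[simp] theorem deg_mul (a b : LaurentAffine) : (a * b).deg = a.deg + b.deg := rfl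
@[simp] theorem shift_one : (1 : LaurentAffine).shift = 0 := rfl
@[simp] theorem deg_one : (1 : LaurentAffine).deg = 0 := rfl
@[simp] theorem shift_inv (a : LaurentAffine) : a⁻¹.shift = -(T (-a.deg) * a.shift) := rfl
@[simp] theorem deg_inv (a : LaurentAffine) : a⁻¹.deg = -a.deg := rfl

noncomputable instance : Group LaurentAffine :=
  Group.ofLeftAxioms
    (fun a b c => by
      ext1
      · simp only [shift_mul, deg_mul, T_add]; ring
      · simp only [deg_mul]; ring)
    (fun a => by ext1 <;> simp)
    (fun a => by ext1 <;> simp)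

variable {X : Type*} [DecidableEq X]

theorem deg_eq_erase_add (ψ : FreeMonoid X →* LaurentAffine) (x : X) (w : FreeMonoid X) :
    (ψ w).deg = (ψ (map Subtype.val (erase x w))).deg + w.toList.count x * (ψ (of x)).deg := by
  induction w using FreeMonoid.inductionOn' with
  | one => simp
  | of_mul a w ih =>
    rcases eq_or_ne a x with rfl | ha
    · rw [map_mul, map_mul, erase_of_self, one_mul, toList_of_mul, List.count_cons_self, deg_mul,
        ih]
      push_cast
      ring
    · rw [map_mul, map_mul, erase_of_ne ha, toList_of_mul, List.count_cons_of_ne ha, deg_mul,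
        ih, map_mul, map_mul, deg_mul, map_of]
      ring

/-- When `x` acts as a translation, each of its occurrences contributes its shift times a power of
`T`. The coefficient `c` sums these powers, so setting `T = 1` counts the occurrences. -/
theorem exists_shift_eq_erase_add (ψ : FreeMonoid X →* LaurentAffine) {x : X}
    (hx : (ψ (of x)).deg = 0) (w : FreeMonoid X) :
    ∃ c : ℤ[T;T⁻¹], LaurentPolynomial.eval₂ (RingHom.id ℤ) 1 c = w.toList.count x ∧
      (ψ w).shift = (ψ (map Subtype.val (erase x w))).shift + c * (ψ (of x)).shift := by
  induction w using FreeMonoid.inductionOn' with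
  | one => exact ⟨0, by simp, by simp⟩
  | of_mul a w ih =>
    obtain ⟨c, hc, hw⟩ := ih
    rcases eq_or_ne a x with rfl | ha
    · refine ⟨1 + c, ?_, ?_⟩
      · rw [map_add, map_one, hc, toList_of_mul, List.count_cons_self]
        push_cast
        ring
      · rw [map_mul, map_mul, erase_of_self, one_mul, shift_mul, hw, hx, T_zero]
        ring
    · refine ⟨T (ψ (of a)).deg * c, ?_, ?_⟩
      · rw [map_mul, hc, LaurentPolynomial.eval₂_T, toList_of_mul, List.count_cons_of_ne ha]
        simp
      · rw [map_mul, map_mul, erase_of_ne ha, shift_mul, hw, map_mul, map_mul, shift_mul, map_of]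
        ring

/-- Comparing degrees makes `x` a translation; comparing shifts then multiplies its shift by `c -
d`, which is nonzero at `T = 1`, and the ring is a domain. -/
theorem killsErased (X : Type*) [DecidableEq X] : KillsErased X LaurentAffine := by
  intro ψ x u v huv hcount h
  have hcount' : ((u.toList.count x : ℤ) - v.toList.count x) ≠ 0 :=
    sub_ne_zero.2 (Nat.cast_injective.ne hcount)
  have hdeg : (ψ (of x)).deg = 0 := by
    have hu := deg_eq_erase_add ψ x u
    rw [h, deg_eq_erase_add ψ x v, huv] at hu
    refine (mul_eq_zero.1 ?_).resolve_left hcount'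
    linarith
  obtain ⟨c, hc, hcu⟩ := exists_shift_eq_erase_add ψ hdeg u
  obtain ⟨d, hd, hdv⟩ := exists_shift_eq_erase_add ψ hdeg v
  have hcd : c - d ≠ 0 := fun e => by
    apply hcount'
    rw [← hc, ← hd, ← map_sub, e, map_zero]
  rw [h, hdv, huv] at hcu
  ext1
  · refine (mul_eq_zero.1 ?_).resolve_left hcd
    rw [sub_mul, sub_eq_zero]
    exact (add_left_cancel hcu).symm
  · exact hdeg

/-! ### Faithfulness of the position representations -/

variable {S : Type*} [DecidableEq S]

/-- The representation of words recording the positions of the letter `s`. -/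
noncomputable def position (s : S) : FreeMonoid S →* LaurentAffine :=
  lift fun c => ⟨if c = s then 1 else 0, 1⟩

theorem position_of_mul (s c : S) (w : FreeMonoid S) :
    (position s (of c * w)).shift = (if c = s then 1 else 0) + T 1 * (position s w).shift := by
  simp [position]

open Polynomial in
theorem exists_toLaurent_eq_position (s : S) (w : FreeMonoid S) :
    ∃ p : ℤ[X], p.toLaurent = (position s w).shift := by
  induction w using FreeMonoid.inductionOn' with
  | one => exact ⟨0, by simp⟩
  | of_mul c w ih =>
    obtain ⟨p, hp⟩ := ih
    refine ⟨(if c = s then 1 else 0) + Polynomial.X * p, ?_⟩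
    rw [position_of_mul, map_add, map_mul, hp, Polynomial.toLaurent_X]
    split_ifs <;> simp

/-- The shifts are genuine polynomials, so constant coefficients can be compared and `T` cancelled;
this reads off the first letter. -/
theorem eq_zero_of_add_T_mul_eq {s : S} {a b : ℤ} {u v : FreeMonoid S}
    (h : LaurentPolynomial.C a + T 1 * (position s u).shift =
      LaurentPolynomial.C b + T 1 * (position s v).shift) :
    a = b ∧ (position s u).shift = (position s v).shift := by
  obtain ⟨p, hp⟩ := exists_toLaurent_eq_position s u
  obtain ⟨q, hq⟩ := exists_toLaurent_eq_position s v
  rw [← hp, ← hq, ← Polynomial.toLaurent_C, ← Polynomial.toLaurent_C, ← Polynomial.toLaurent_X,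
    ← map_mul, ← map_mul, ← map_add, ← map_add, Polynomial.toLaurent_inj] at h
  have hab : a = b := by simpa using congrArg (fun r => Polynomial.coeff r 0) h
  subst hab
  rw [← hp, ← hq, mul_left_cancel₀ Polynomial.X_ne_zero (add_left_cancel h)]
  exact ⟨rfl, rfl⟩

theorem eq_of_position_eq {u v : FreeMonoid S} (h : ∀ s, position s u = position s v) :
    u = v := by
  have h' : ∀ s, (position s u).shift = (position s v).shift := fun s => by rw [h]
  clear h
  induction u using FreeMonoid.inductionOn' generalizing v with
  | one =>
    by_contra hv
    obtain ⟨c, v, rfl⟩ := exists_eq_of_mul (Ne.symm hv)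
    have := h' c
    rw [position_of_mul, if_pos rfl] at this
    -- The empty word has shift `0`, written as `0 + T * 0`.
    have := (eq_zero_of_add_T_mul_eq (s := c) (a := 0) (b := 1) (u := 1) (v := v)
      (by simpa using this)).1
    omega
  | of_mul c u ih =>
    rcases eq_or_ne v 1 with rfl | hv
    · have := h' c
      rw [position_of_mul, if_pos rfl] at this
      have := (eq_zero_of_add_T_mul_eq (s := c) (a := 1) (b := 0) (u := u) (v := 1)
        (by simpa using this)).1
      omega
    · obtain ⟨d, v, rfl⟩ := exists_eq_of_mul hv
      have key : ∀ s, (if c = s then (1 : ℤ) else 0) = (if d = s then 1 else 0) ∧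
          (position s u).shift = (position s v).shift := fun s => by
        have := h' s
        rw [position_of_mul, position_of_mul] at this
        refine eq_zero_of_add_T_mul_eq ?_
        convert this using 2 <;> split_ifs <;> simp
      have hcd : d = c := by
        have := (key c).1
        by_contra hne
        simp [hne] at this
      rw [hcd, ih fun s => (key s).2]

end LaurentAffine

end Affine

/-! ### Conclusion -/

theorem entireSystem_subset {X S : Type*} [Fintype X] [DecidableEq X]
    {g h : FreeMonoid X →* FreeMonoid S} (hg : Fintype.card X ≤ morphismRank g + 1)
    {E : WordEquation X} (hE : ¬ E.Balanced) (hEg : E.IsSolution g) (hEh : E.IsSolution h) :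
    entireSystem g ⊆ entireSystem h := by
  classical
  intro F hF
  refine LaurentAffine.eq_of_position_eq fun s => ?_
  exact eq_of_unbalanced (LaurentAffine.killsErased X) g hg hE hEg hF
    ((LaurentAffine.position s).comp h) (congrArg (LaurentAffine.position s) hEh)

end WordEquation

theorem mainTheorem6 {X S : Type*} [Fintype X] [DecidableEq X] (n : ℕ)
    (hn : Fintype.card X = n) (g h : FreeMonoid X →* FreeMonoid S)
    (hg : (morphismRank g : ℤ) = (n : ℤ) - 1) (hh : (morphismRank h : ℤ) = (n : ℤ) - 1)
    (hK : WordEquation.entireSystem g ≠ WordEquation.entireSystem h) :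
    ∀ E ∈ WordEquation.entireSystem g ∩ WordEquation.entireSystem h, E.Balanced := by
  rintro E ⟨hEg, hEh⟩
  by_contra hE
  exact hK (Set.Subset.antisymm
    (WordEquation.entireSystem_subset (by omega) hE hEg hEh)
    (WordEquation.entireSystem_subset (by omega) hE hEh hEg))
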